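/- Let $\mathbb K$ be a field of characteristic zero and let $\mathrm{NCP}$ be the set of nonempty noncrossing partitions of the sets $[n]=\{1,\dots,n\}$, $n\ge 1$. Let $H$ be the free associative unital $\mathbb K$-algebra on $\mathrm{NCP}$, with counit $\varepsilon$ (the algebra map with $\varepsilon(P)=0$ for $P\in\mathrm{NCP}$) and augmentation ideal $H_+=\ker\varepsilon$; its linear basis consists of the words $P_1\cdots P_k$. Let $B$ be the free commutative algebra on $\mathrm{NCP}$. For blocks $\pi,\rho$ of $P$ write $\pi\to\rho$ if $[\min\pi,\max\pi]\cap\rho\neq\emptyset$. A cut $(L,U)$ of $P$ is a splitting of its set of blocks into a lowerset $L$ and its complement $U$, an upperset, for this relation. If $x_1<\dots<x_k$ are the elements lying in the blocks of $L$, the reduced gap monomial $\overline{U}\in H$ is the product, for $i=0,\dots,k$ in this order, of the standardized restrictions of $P$ to the gaps $\{y: x_i<y<x_{i+1}\}$ ($x_0=-\infty$, $x_{k+1}=+\infty$), where the empty partition is replaced by $1$. The coproduct $\Delta:H\to H\otimes H$ is the algebra map with $\Delta(P)=\sum_{(L,U)}L\otimes\overline U$, the sum being over all cuts of $P$, with $L$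 standardized and replaced by $1$ if empty. The right half-coproduct is the linear map on $H_+$ given on nonempty words by $$\Delta_\succ(P_1\cdots P_k)=\Big(\sum_{(L,U):\,1\in U}L\otimes\overline U\Big)\,\Delta(P_2)\cdots\Delta(P_k),$$ the sum being over the cuts of $P_1$ for which the element $1$ of $P_1$ lies in a block of $U$. For linear forms $\alpha,\beta$ on $H$ with $\beta(1)=0$, the form $\alpha\succ\beta$ is $(\alpha\otimes\beta)\circ\Delta_\succ$ on $H_+$, and it vanishes at $1$. Let $\rho:H\to H\otimes B$ be the algebra map with $\rho(P)=\sum_{Q\ge P}Q\otimes P/Q$, where $Q$ runs over the noncrossing partitions coarser than or equal to $P$ and $P/Q\in B$ is the product over the blocks $\tau$ of $Q$ of the standardized restrictions $P_{|\tau}$. For a linear form $\alpha$ on $H$ and a character $\chi$ of $B$ put $\alpha\curvearrowleft\chi=(\alpha\otimes\chi)\circ\rho$. A character of $H$ or of $B$ is a unital algebra map to $\mathbb K$; an infinitesimal character of $H$ is a linear form vanishing at $1$ and on $(H_+)^2$. Let $e$ be the infinitesimal character of $H$ with $e(P)=1$ if $P\in\mathrm{NCP}$ has exactly one block and $e(P)=0$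 for all other $P\in\mathrm{NCP}$. **Theorem.** There is exactly one linear form $\psi_\succ$ on $H$ with $\psi_\succ=\varepsilon+\psi_\succ\succ e$, and it is a character of $H$; it is denoted $\psi_\succ=\mathcal E_\succ(e)$. Let $\kappa$ be an infinitesimal character of $H$, and let $K$ be the character of $B$ with $K(P)=\kappa(P)$ for all $P\in\mathrm{NCP}$. Then, for every character $\phi$ of $H$, $$\phi=\varepsilon+\phi\succ\kappa\quad\Longleftrightarrow\quad\phi=\psi_\succ\curvearrowleft K.$$ -/

import Mathlib

open scoped TensorProduct

noncomputable section

namespace GapInsertion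

/-! ### Noncrossing partitions -/

/-- A set partition of `[n]`, given by its equivalence relation `s` on `Fin n` (`Fin n` being the
standard `n`-element chain), is noncrossing when no two distinct blocks contain `a, b` and `c, d`
with `a < c < b < d`.  In the order on `Setoid (Fin n)`, `s ≤ t` means that `s` is finer. -/
def IsNoncrossing {n : ℕ} (s : Setoid (Fin n)) : Prop :=
  ∀ a c b d : Fin n, a < c → c < b → b < d → s a b → s c d → s a c

/-- Nonempty (standard) noncrossing partitions. -/
structure NCP where
  deg : ℕ
  deg_pos : 0 < deg
  rel : Setoid (Fin deg)
  noncrossing : IsNoncrossing rel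

open scoped Classical in
/-- The set of blocks of a partition of `[n]`. -/
def blocks {n : ℕ} (s : Setoid (Fin n)) : Finset (Finset (Fin n)) :=
  Finset.univ.image fun x => Finset.univ.filter fun y => s x y

theorem IsNoncrossing.comap {n m : ℕ} {s : Setoid (Fin n)} (hs : IsNoncrossing s)
    (f : Fin m ↪o Fin n) : IsNoncrossing (Setoid.comap f s) :=
  fun a c b d hac hcb hbd hab hcd =>
    hs (f a) (f c) (f b) (f d) (f.lt_iff_lt.2 hac) (f.lt_iff_lt.2 hcb) (f.lt_iff_lt.2 hbd) hab hcd

/-- The standardization of the restriction `P_{|X}` to a nonempty subset `X` of `[n]`, obtained by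
transport along the increasing bijection `[#X] → X`. -/
def NCP.restrict (P : NCP) (X : Finset (Fin P.deg)) (hX : X.Nonempty) : NCP where
  deg := X.card
  deg_pos := hX.card_pos
  rel := Setoid.comap (X.orderEmbOfFin rfl) P.rel
  noncrossing := P.noncrossing.comap _

/-- The monomial, for a given realization `f` of noncrossing partitions as elements of an algebra,
of the possibly empty partition `P_{|X}`; the empty partition is identified with `1`. -/
def NCP.monom {M : Type*} [One M] (f : NCP → M) (P : NCP) (X : Finset (Fin P.deg)) : M :=
  if hX : X.Nonempty then f (P.restrict X hX) else 1

/-! ### Cuts -/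

/-- `Nests s x y`: the convex hull of the block of `x` meets the block of `y`. -/
def Nests {n : ℕ} (s : Setoid (Fin n)) (x y : Fin n) : Prop :=
  ∃ a b z : Fin n, s x a ∧ s x b ∧ s y z ∧ a ≤ z ∧ z ≤ b

/-- A lowerset of blocks, given as the union `L ⊆ [n]` of these blocks.  (`Nests s x y` holds
whenever `x, y` are in the same block, so such an `L` is a union of blocks; being closed under the
relation is the same as being closed under its transitive closure.)  The complement of `L` is the
corresponding upperset, and the cuts `(L, U)` of a partition are indexed by the lowersets `L`. -/
def IsLowerset {n : ℕ} (s : Setoid (Fin n)) (L : Finset (Fin n)) : Prop :=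
  ∀ x y : Fin n, Nests s x y → y ∈ L → x ∈ L

/-- For `L = {x₁ < ⋯ < x_k} ⊆ [n]` and `0 ≤ i ≤ k`, the set of `y ∉ L` with `x_i < y < x_{i+1}`
(no lower bound for `i = 0`, no upper bound for `i = k`). -/
def gap {n : ℕ} (L : Finset (Fin n)) (i : ℕ) : Finset (Fin n) :=
  Finset.univ.filter fun y => y ∉ L ∧ (L.filter fun x => x < y).card = i

open scoped Classical in
/-- The lowersets of `P`, that is, the cuts of `P`. -/
def NCP.cuts (P : NCP) : Finset (Finset (Fin P.deg)) :=
  Finset.univ.filter fun L => IsLowerset P.rel L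

/-! ### The two algebras and the (half-)coproducts -/

variable (𝕂 : Type*) [Field 𝕂]

/-- The underlying algebra of the gap-insertion Hopf algebra: the free associative algebra on the
nonempty noncrossing partitions. -/
abbrev Hgap := FreeAlgebra 𝕂 NCP

/-- The underlying algebra of the block-substitution bialgebra: the free commutative algebra on the
nonempty noncrossing partitions. -/
abbrev Bbl := MvPolynomial NCP 𝕂

/-- The generator of `Hgap 𝕂` given by a noncrossing partition. -/
def gen (P : NCP) : Hgap 𝕂 := FreeAlgebra.ι 𝕂 P

/-- The monomials (words) in noncrossing partitions form a linear basis. -/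
def wordBasis : Module.Basis (FreeMonoid NCP) 𝕂 (Hgap 𝕂) := FreeAlgebra.basisFreeMonoid 𝕂 NCP

/-- The counit of `Hgap 𝕂`: the character which vanishes on all nonempty noncrossing partitions. -/
def counit : Hgap 𝕂 →ₐ[𝕂] 𝕂 := FreeAlgebra.lift 𝕂 fun _ => 0

/-- The reduced gap monomial of the upperset with complement `L`. -/
def gapMonomial (P : NCP) (L : Finset (Fin P.deg)) : Hgap 𝕂 :=
  ((List.range (L.card + 1)).map fun i => P.monom (gen 𝕂) (gap L i)).prod

/-- The term `L ⊗ U` of the coproduct given by a cut. -/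
def cutTerm (P : NCP) (L : Finset (Fin P.deg)) : Hgap 𝕂 ⊗[𝕂] Hgap 𝕂 :=
  P.monom (gen 𝕂) L ⊗ₜ[𝕂] gapMonomial 𝕂 P L

/-- The coproduct of `Hgap 𝕂`. -/
def coproduct : Hgap 𝕂 →ₐ[𝕂] Hgap 𝕂 ⊗[𝕂] Hgap 𝕂 :=
  FreeAlgebra.lift 𝕂 fun P => ∑ L ∈ P.cuts, cutTerm 𝕂 P L

/-- The right half-coproduct on words.  A cut of a word `P₁ ⋯ P_k` is a sequence of cuts of the
`P_i`, its first element `1` is the first element of `P₁`, and only the cuts are kept where `1`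
lies in the upperset.  The half-coproduct is defined on the augmentation ideal only, and it is
extended by `0` to the empty word. -/
def coproductSuccWord : List NCP → Hgap 𝕂 ⊗[𝕂] Hgap 𝕂
  | [] => 0
  | P :: w => (∑ L ∈ P.cuts.filter (fun L => (⟨0, P.deg_pos⟩ : Fin P.deg) ∉ L), cutTerm 𝕂 P L) *
      coproduct 𝕂 (w.map (gen 𝕂)).prod

/-- The right half-coproduct. -/
def coproductSucc : Hgap 𝕂 →ₗ[𝕂] Hgap 𝕂 ⊗[𝕂] Hgap 𝕂 :=
  (wordBasis 𝕂).constr 𝕂 fun w => coproductSuccWord 𝕂 w.toList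

open scoped Classical in
instance instFintypeCoarser {n : ℕ} (s : Setoid (Fin n)) :
    Fintype {t : Setoid (Fin n) // s ≤ t ∧ IsNoncrossing t} :=
  haveI : Finite (Setoid (Fin n)) :=
    Finite.of_injective (fun (t : Setoid (Fin n)) (x y : Fin n) => t x y)
      fun _ _ h => Setoid.ext fun x y => iff_of_eq (congrFun (congrFun h x) y)
  Fintype.ofFinite _

/-- The fibre monomial `P/Q`: the product, over the blocks `τ` of `Q`, of the `P_{|τ}`. -/
def fibre (P : NCP) (Q : Setoid (Fin P.deg)) : Bbl 𝕂 :=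
  ∏ τ ∈ blocks Q, P.monom MvPolynomial.X τ

/-- The coaction of `Bbl 𝕂` on `Hgap 𝕂`: the algebra homomorphism such that
`P ↦ ∑_{P ≤ Q} Q ⊗ P/Q`, with `Q` running over the noncrossing partitions coarser than `P`. -/
def coaction : Hgap 𝕂 →ₐ[𝕂] Hgap 𝕂 ⊗[𝕂] Bbl 𝕂 :=
  FreeAlgebra.lift 𝕂 fun P =>
    ∑ Q : {t : Setoid (Fin P.deg) // P.rel ≤ t ∧ IsNoncrossing t},
      gen 𝕂 ⟨P.deg, P.deg_pos, Q.1, Q.2.2⟩ ⊗ₜ[𝕂] fibre 𝕂 P Q.1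

variable {𝕂}

/-! ### Linear forms, characters and infinitesimal characters -/

/-- The right half-shuffle product `α ≻ β = (α ⊗ β) ∘ Δ_≻` of linear forms, for `β(1) = 0`.
(As `Δ_≻(x)` is `1 ⊗ x` plus terms in the tensor square of the augmentation ideal, it satisfies
`ε ≻ β = β`, and `α ≻ β` vanishes at `1`.) -/
def succ (α β : Module.Dual 𝕂 (Hgap 𝕂)) : Module.Dual 𝕂 (Hgap 𝕂) :=
  LinearMap.mul' 𝕂 𝕂 ∘ₗ TensorProduct.map α β ∘ₗ coproductSucc 𝕂

/-- The right action `α ↶ χ = (α ⊗ χ) ∘ ρ` of a character of `Bbl 𝕂` on a linear form. -/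
def act (α : Module.Dual 𝕂 (Hgap 𝕂)) (χ : Bbl 𝕂 →ₐ[𝕂] 𝕂) : Module.Dual 𝕂 (Hgap 𝕂) :=
  LinearMap.mul' 𝕂 𝕂 ∘ₗ TensorProduct.map α χ.toLinearMap ∘ₗ (coaction 𝕂).toLinearMap

/-- Infinitesimal characters: linear forms vanishing at `1` and on the square of the augmentation
ideal. -/
def IsInfinitesimal (κ : Module.Dual 𝕂 (Hgap 𝕂)) : Prop :=
  κ 1 = 0 ∧ ∀ x y : Hgap 𝕂, counit 𝕂 x = 0 → counit 𝕂 y = 0 → κ (x * y) = 0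

/-- The character of `Hgap 𝕂` which agrees with `κ` on all noncrossing partitions. -/
def theta (κ : Module.Dual 𝕂 (Hgap 𝕂)) : Hgap 𝕂 →ₐ[𝕂] 𝕂 :=
  FreeAlgebra.lift 𝕂 fun P => κ (gen 𝕂 P)

/-- The character of `Bbl 𝕂` corresponding to a character of `Hgap 𝕂`. -/
def bar (φ : Hgap 𝕂 →ₐ[𝕂] 𝕂) : Bbl 𝕂 →ₐ[𝕂] 𝕂 :=
  MvPolynomial.aeval fun P => φ (gen 𝕂 P)

variable (𝕂)

/-- The infinitesimal character `e`: it is `1` on noncrossing partitions with exactly one block,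
and `0` on all other words in noncrossing partitions. -/
def eForm : Module.Dual 𝕂 (Hgap 𝕂) :=
  (wordBasis 𝕂).constr 𝕂 fun w =>
    match w.toList with
    | [P] => if (blocks P.rel).card = 1 then 1 else 0
    | _ => 0

variable {𝕂}

/-- The fixpoint equation `φ = ε + φ ≻ κ`. -/
def RightFixpoint (κ φ : Module.Dual 𝕂 (Hgap 𝕂)) : Prop :=
  φ = (counit 𝕂).toLinearMap + succ φ κ

/-- The right half-shuffle exponential: the character `φ` with `φ = ε + φ ≻ κ`. -/
def rightExp (κ : Module.Dual 𝕂 (Hgap 𝕂)) : Hgap 𝕂 →ₐ[𝕂] 𝕂 :=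
  haveI : Nonempty (Hgap 𝕂 →ₐ[𝕂] 𝕂) := ⟨counit 𝕂⟩
  Classical.epsilon fun φ : Hgap 𝕂 →ₐ[𝕂] 𝕂 => RightFixpoint κ φ.toLinearMap

variable (𝕂)

/-- The universal character `ψ_≻`. -/
def psiSucc : Hgap 𝕂 →ₐ[𝕂] 𝕂 := rightExp (eForm 𝕂)

end GapInsertion

end

noncomputable section

namespace GapInsertion

open Finset

variable {𝕂 : Type*} [Field 𝕂]

/-! ### Words -/

/-! Paired with an infinitesimal character `κ` on the right leg, the half-coproduct of a word `P w`
loses almost all its terms. Since `1 ∈ U`, the gap before the first element of `L` is nonempty and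
contributes a letter. As `κ` kills products of two elements of the augmentation ideal, all other
gaps of `P` must be empty and the rest of the word must lie entirely in the left leg. What survives
are the cuts where `L` is a proper final segment and a union of blocks (`tails`). The fixpoint
equation thus becomes the recursion `φ(P w) = ∑_L κ(P_{|Lᶜ}) φ(P_{|L} w)` with `φ(1) = 1`
(`rightFixpoint_iff`).

Each step lowers the total degree, so the solution is unique among linear forms
(`RightFixpoint.unique`). Iterating the recursion peels off initial intervals one at a time, so the
solution is the character sending `P` to the sum, over interval partitions `Q ≥ P`, of `∏ κ(P_{|τ})`
over the blocks `τ` of `Q` (`intervalSum_rec`, `rightFixpoint_intervalCharacter`).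

For `κ = e` only `Q = P` can contribute, so `ψ_≻` is the indicator of interval partitions.
Substituting this in `(ψ_≻ ⊗ K) ∘ ρ` restricts the sum over noncrossing `Q ≥ P` to interval
partitions and returns the same formula for general `κ` (`act_psiSucc`). Uniqueness then gives both
implications. -/

theorem wordBasis_apply (w : FreeMonoid NCP) :
    wordBasis 𝕂 w = (w.toList.map (gen 𝕂)).prod := by
  have h : wordBasis 𝕂 w =
      FreeAlgebra.equivMonoidAlgebraFreeMonoid.symm (MonoidAlgebra.of 𝕂 (FreeMonoid NCP) w) := rfl
  rw [h]
  simp [FreeAlgebra.equivMonoidAlgebraFreeMonoid, FreeMonoid.lift_apply]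
  rfl

theorem dual_ext_words {α β : Module.Dual 𝕂 (Hgap 𝕂)}
    (h : ∀ w : List NCP, α (w.map (gen 𝕂)).prod = β (w.map (gen 𝕂)).prod) : α = β :=
  (wordBasis 𝕂).ext fun w => by simpa only [wordBasis_apply] using h w.toList

@[simp]
theorem counit_gen (P : NCP) : counit 𝕂 (gen 𝕂 P) = 0 := by
  simp [counit, gen]

theorem coproductSucc_word (w : List NCP) :
    coproductSucc 𝕂 (w.map (gen 𝕂)).prod = coproductSuccWord 𝕂 w := by
  have h := (wordBasis 𝕂).constr_basis 𝕂 (fun w => coproductSuccWord 𝕂 w.toList)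
    (FreeMonoid.ofList w)
  rwa [wordBasis_apply] at h

theorem eForm_word (w : List NCP) :
    eForm 𝕂 (w.map (gen 𝕂)).prod =
      match w with
      | [P] => if (blocks P.rel).card = 1 then 1 else 0
      | _ => 0 := by
  have h := (wordBasis 𝕂).constr_basis 𝕂 (fun w : FreeMonoid NCP =>
    match w.toList with
    | [P] => if (blocks P.rel).card = 1 then (1 : 𝕂) else 0
    | _ => 0) (FreeMonoid.ofList w)
  rwa [wordBasis_apply] at h

theorem eForm_gen (P : NCP) :
    eForm 𝕂 (gen 𝕂 P) = if (blocks P.rel).card = 1 then 1 else 0 := by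
  simpa using eForm_word (𝕂 := 𝕂) [P]

/-- The derivation rule over the counit, checked on pairs of basis words; it makes `e` vanish on the
square of the augmentation ideal. -/
theorem eForm_mul (x y : Hgap 𝕂) :
    eForm 𝕂 (x * y) = eForm 𝕂 x * counit 𝕂 y + counit 𝕂 x * eForm 𝕂 y := by
  have key : (LinearMap.mul 𝕂 (Hgap 𝕂)).compr₂ (eForm 𝕂) =
      (LinearMap.mul 𝕂 𝕂).compl₁₂ (eForm 𝕂) (counit 𝕂).toLinearMap +
        (LinearMap.mul 𝕂 𝕂).compl₁₂ (counit 𝕂).toLinearMap (eForm 𝕂) := by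
    refine (wordBasis 𝕂).ext fun u => (wordBasis 𝕂).ext fun v => ?_
    simp only [wordBasis_apply]
    generalize u.toList = u
    generalize v.toList = v
    simp only [LinearMap.compr₂_apply, LinearMap.mul_apply', LinearMap.add_apply,
      LinearMap.compl₁₂_apply, AlgHom.toLinearMap_apply]
    rw [← List.prod_append, ← List.map_append, eForm_word, eForm_word, eForm_word]
    rcases u with _ | ⟨P, _ | ⟨P', u⟩⟩ <;> rcases v with _ | ⟨R, _ | ⟨R', v⟩⟩ <;> simp
  simpa using LinearMap.congr_fun₂ key x y

theorem isInfinitesimal_eForm : IsInfinitesimal (eForm 𝕂) := by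
  refine ⟨by simpa using eForm_word (𝕂 := 𝕂) [], fun x y hx hy => ?_⟩
  rw [eForm_mul, hx, hy]
  simp

/-- Modulo the augmentation ideal, `y` is the scalar `ε(y)`. -/
theorem IsInfinitesimal.apply_mul {κ : Module.Dual 𝕂 (Hgap 𝕂)} (hκ : IsInfinitesimal κ)
    {x : Hgap 𝕂} (hx : counit 𝕂 x = 0) (y : Hgap 𝕂) : κ (x * y) = κ x * counit 𝕂 y := by
  have h := hκ.2 x (y - algebraMap 𝕂 _ (counit 𝕂 y)) hx (by simp)
  rw [mul_sub, map_sub, sub_eq_zero] at h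
  rw [h, ← Algebra.commutes, ← Algebra.smul_def, map_smul, smul_eq_mul, mul_comm]

/-! ### Restrictions -/

/-- A finite chain has no order automorphism but the identity, so isomorphic standard partitions are
equal. -/
theorem NCP.ext_of_orderIso {P Q : NCP} (f : Fin P.deg ≃o Fin Q.deg)
    (h : ∀ x y, P.rel x y ↔ Q.rel (f x) (f y)) : P = Q := by
  obtain ⟨n, hn, r, hr⟩ := P
  obtain ⟨m, hm, s, hs⟩ := Q
  obtain rfl : n = m := by simpa using Fintype.card_congr f.toEquiv
  obtain rfl : f = OrderIso.refl _ := Subsingleton.elim _ _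
  obtain rfl : r = s := Setoid.ext h
  rfl

/-- Restriction along an arbitrary increasing enumeration of a subset. -/
theorem NCP.eq_restrict (P R : NCP) (X : Finset (Fin P.deg)) (hX : X.Nonempty)
    (f : Fin R.deg ↪o Fin P.deg) (hf : univ.map f.toEmbedding = X)
    (h : ∀ x y, R.rel x y ↔ P.rel (f x) (f y)) : R = P.restrict X hX := by
  subst hf
  have hc : R.deg = (univ.map f.toEmbedding).card := by simp
  refine NCP.ext_of_orderIso (Fin.castOrderIso hc) fun x y => ?_
  have : ∀ x, (univ.map f.toEmbedding).orderEmbOfFin rfl (Fin.castOrderIso hc x) = f x := by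
    intro x
    have h1 := Finset.orderEmbOfFin_unique (s := univ.map f.toEmbedding) (k := R.deg) hc.symm
      (f := f) (by simp) f.strictMono
    rw [h1, Finset.orderEmbOfFin_apply, Finset.orderEmbOfFin_apply]
    rfl
  rw [h, ← this x, ← this y]
  rfl

/-- Transitivity of restriction, including the empty case. -/
theorem NCP.monom_restrict {M : Type*} [One M] (g : NCP → M) (P : NCP) (X : Finset (Fin P.deg))
    (hX : X.Nonempty) (Y : Finset (Fin X.card)) :
    (P.restrict X hX).monom g Y = P.monom g (Y.map (X.orderEmbOfFin rfl).toEmbedding) := by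
  by_cases hY : Y.Nonempty
  · have hY' : (Y.map (X.orderEmbOfFin rfl).toEmbedding).Nonempty := by simpa using hY
    unfold NCP.monom
    rw [dif_pos hY', dif_pos (show Finset.Nonempty (α := Fin (P.restrict X hX).deg) Y from hY)]
    congr 1
    refine P.eq_restrict _ _ hY' ((Y.orderEmbOfFin rfl).trans (X.orderEmbOfFin rfl)) ?_
      fun x y => Iff.rfl
    ext x
    have h1 : ∀ z : Fin X.card, z ∈ Y ↔ ∃ i, Y.orderEmbOfFin rfl i = z := fun z => by
      rw [← Set.mem_range, Finset.range_orderEmbOfFin, Finset.mem_coe]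
    simp only [mem_map, mem_univ, true_and, h1]
    constructor
    · rintro ⟨i, rfl⟩
      exact ⟨_, ⟨i, rfl⟩, rfl⟩
    · rintro ⟨_, ⟨i, rfl⟩, rfl⟩
      exact ⟨i, rfl⟩
  · rw [not_nonempty_iff_eq_empty] at hY
    subst hY
    rw [Finset.map_empty]
    simp only [NCP.monom, Finset.not_nonempty_empty, dite_false]
    exact dif_neg Finset.not_nonempty_empty

theorem NCP.restrict_univ (P : NCP) (h : (univ : Finset (Fin P.deg)).Nonempty) :
    P.restrict univ h = P :=
  (P.eq_restrict P univ h (RelEmbedding.refl _) (by ext; simp) fun _ _ => Iff.rfl).symm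

theorem map_monom {M N F : Type*} [MulOneClass M] [MulOneClass N] [FunLike F M N]
    [MonoidHomClass F M N] (g : F) (f : NCP → M) (P : NCP) (X : Finset (Fin P.deg)) :
    g (P.monom f X) = P.monom (fun R => g (f R)) X := by
  unfold NCP.monom
  split_ifs <;> simp

/-! ### The half-coproduct against an infinitesimal character -/

theorem univ_mem_cuts (P : NCP) : univ ∈ P.cuts := by
  classical
  simp only [NCP.cuts, mem_filter]
  exact ⟨mem_univ _, fun _ _ _ _ => mem_univ _⟩

theorem gap_subset_compl {n : ℕ} (L : Finset (Fin n)) (i : ℕ) : gap L i ⊆ Lᶜ := by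
  intro y
  simp +contextual [gap]

theorem counit_gapMonomial (P : NCP) (L : Finset (Fin P.deg)) :
    counit 𝕂 (gapMonomial 𝕂 P L) = if L = univ then 1 else 0 := by
  unfold gapMonomial
  rw [map_list_prod, List.map_map]
  split_ifs with h
  · subst h
    refine List.prod_eq_one fun x hx => ?_
    obtain ⟨i, -, rfl⟩ := List.mem_map.1 hx
    have : gap (univ : Finset (Fin P.deg)) i = ∅ := by simp [gap]
    simp [this, NCP.monom]
  · obtain ⟨y, hy⟩ : ∃ y, y ∉ L := by simpa [Finset.eq_univ_iff_forall] using h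
    refine List.prod_eq_zero (List.mem_map.2 ⟨(L.filter fun x => x < y).card, ?_, ?_⟩)
    · rw [List.mem_range, Nat.lt_succ_iff]
      exact card_filter_le _ _
    · have : (gap L (L.filter fun x => x < y).card).Nonempty := ⟨y, by simp [gap, hy]⟩
      simp [NCP.monom, this]

/-- The right counit axiom: a cut with `L` not everything has a nonempty gap, whose letter is killed
by `ε`. -/
theorem coproduct_counit (x : Hgap 𝕂) :
    Algebra.TensorProduct.rid 𝕂 𝕂 (Hgap 𝕂)
      (Algebra.TensorProduct.map (AlgHom.id 𝕂 _) (counit 𝕂) (coproduct 𝕂 x)) = x := by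
  suffices h : ((Algebra.TensorProduct.rid 𝕂 𝕂 (Hgap 𝕂)).toAlgHom.comp
      (Algebra.TensorProduct.map (AlgHom.id 𝕂 _) (counit 𝕂))).comp (coproduct 𝕂) =
        AlgHom.id 𝕂 _ from DFunLike.congr_fun h x
  refine FreeAlgebra.hom_ext (funext fun P => ?_)
  have hP : (univ : Finset (Fin P.deg)).Nonempty := ⟨⟨0, P.deg_pos⟩, mem_univ _⟩
  simp only [coproduct, cutTerm, Function.comp_apply, AlgHom.comp_apply, FreeAlgebra.lift_ι_apply,
    map_sum, Algebra.TensorProduct.map_tmul, counit_gapMonomial, AlgHom.id_apply]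
  rw [Finset.sum_eq_single_of_mem _ (univ_mem_cuts P)]
  · simp only [if_true, NCP.monom, dif_pos hP, NCP.restrict_univ]
    simp [gen]
  · intro L _ hL
    simp [hL]

/-- Once `y` has used up the single letter that `κ` tolerates, `κ` acts on the right leg of `z` as
`ε`. With `z` a coproduct, the counit axiom then applies. -/
theorem apply_tmul_mul {κ : Module.Dual 𝕂 (Hgap 𝕂)} (hκ : IsInfinitesimal κ)
    (α : Module.Dual 𝕂 (Hgap 𝕂)) (x : Hgap 𝕂) {y : Hgap 𝕂} (hy : counit 𝕂 y = 0)
    (z : Hgap 𝕂 ⊗[𝕂] Hgap 𝕂) :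
    LinearMap.mul' 𝕂 𝕂 (TensorProduct.map α κ ((x ⊗ₜ y) * z)) =
      κ y * α (x * Algebra.TensorProduct.rid 𝕂 𝕂 (Hgap 𝕂)
        (Algebra.TensorProduct.map (AlgHom.id 𝕂 _) (counit 𝕂) z)) := by
  induction z with
  | zero => simp
  | add a b ha hb => simp only [mul_add, map_add, ha, hb]
  | tmul a b =>
    simp only [Algebra.TensorProduct.tmul_mul_tmul, TensorProduct.map_tmul, LinearMap.mul'_apply,
      hκ.apply_mul hy, Algebra.TensorProduct.map_tmul, AlgHom.id_apply,
      Algebra.TensorProduct.rid_tmul, mul_smul_comm, map_smul, smul_eq_mul]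
    ring

open scoped Classical in
/-- The proper final segments of `[n]` that are unions of blocks. -/
def tails {n : ℕ} (s : Setoid (Fin n)) : Finset (Finset (Fin n)) :=
  univ.filter fun L => IsUpperSet (L : Set (Fin n)) ∧ L ≠ univ ∧
    ∀ x y : Fin n, s x y → y ∈ L → x ∈ L

theorem mem_tails {n : ℕ} {s : Setoid (Fin n)} {L : Finset (Fin n)} :
    L ∈ tails s ↔ IsUpperSet (L : Set (Fin n)) ∧ L ≠ univ ∧
      ∀ x y : Fin n, s x y → y ∈ L → x ∈ L := by
  simp [tails]

theorem gap_zero_of_isUpperSet {n : ℕ} {L : Finset (Fin n)} (h : IsUpperSet (L : Set (Fin n))) :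
    gap L 0 = Lᶜ := by
  ext y
  simp only [gap, mem_filter, mem_univ, true_and, card_eq_zero, mem_compl, and_iff_left_iff_imp,
    filter_eq_empty_iff]
  exact fun hy x hx hxy => hy (h hxy.le hx)

theorem zero_notMem_iff {n : ℕ} {L : Finset (Fin n)} (h : IsUpperSet (L : Set (Fin n)))
    (hn : 0 < n) : (⟨0, hn⟩ : Fin n) ∉ L ↔ L ≠ univ := by
  rw [not_iff_not, Finset.eq_univ_iff_forall]
  exact ⟨fun h0 x => h (show (⟨0, hn⟩ : Fin n) ≤ x from Nat.zero_le _) h0, fun h0 => h0 _⟩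

/-- A block whose hull meets a block inside the final segment `L` has an element to the right of the
meeting point, hence in `L`. -/
theorem isLowerset_iff {n : ℕ} {s : Setoid (Fin n)} {L : Finset (Fin n)}
    (h : IsUpperSet (L : Set (Fin n))) :
    IsLowerset s L ↔ ∀ x y : Fin n, s x y → y ∈ L → x ∈ L := by
  refine ⟨fun hL x y hxy => hL x y ⟨y, y, y, hxy, hxy, s.refl y, le_rfl, le_rfl⟩, ?_⟩
  rintro hL x y ⟨a, b, z, -, hb, hz, -, hzb⟩ hy
  exact hL x b hb (h hzb (hL z y (s.symm hz) hy))

/-- The gap of index `0` contains the least element, so `κ` sees its letter times the counit of the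
other gaps. These are all empty exactly when `L` is a final segment. -/
theorem infinitesimal_gapMonomial {κ : Module.Dual 𝕂 (Hgap 𝕂)} (hκ : IsInfinitesimal κ)
    (P : NCP) {L : Finset (Fin P.deg)} (hL : (⟨0, P.deg_pos⟩ : Fin P.deg) ∉ L) [Decidable
      (IsUpperSet (L : Set (Fin P.deg)))] :
    counit 𝕂 (gapMonomial 𝕂 P L) = 0 ∧ κ (gapMonomial 𝕂 P L) =
      if IsUpperSet (L : Set (Fin P.deg)) then P.monom (fun R => κ (gen 𝕂 R)) Lᶜ else 0 := by
  have h0 : (gap L 0).Nonempty := ⟨⟨0, P.deg_pos⟩, by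
    simp only [gap, mem_filter, mem_univ, true_and, card_eq_zero, filter_eq_empty_iff]
    exact ⟨hL, fun x _ hx => Nat.not_lt_zero x.1 hx⟩⟩
  have hc : counit 𝕂 (gapMonomial 𝕂 P L) = 0 := by
    rw [counit_gapMonomial, if_neg]
    rintro rfl
    simp at hL
  refine ⟨hc, ?_⟩
  have hm : counit 𝕂 (P.monom (gen 𝕂) (gap L 0)) = 0 := by simp [NCP.monom, h0]
  rw [gapMonomial, List.range_succ_eq_map, List.map_cons, List.prod_cons, hκ.apply_mul hm]
  split_ifs with h
  · have hne : Lᶜ.Nonempty := gap_zero_of_isUpperSet h ▸ h0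
    rw [map_list_prod, List.prod_eq_one, mul_one, gap_zero_of_isUpperSet h]
    · simp [NCP.monom, hne]
    · intro x hx
      simp only [List.map_map, List.mem_map] at hx
      obtain ⟨i, -, rfl⟩ := hx
      have : gap L (i + 1) = ∅ := by
        refine eq_empty_of_forall_notMem fun y hy => ?_
        have hy' := gap_subset_compl _ _ hy
        rw [← gap_zero_of_isUpperSet h] at hy'
        simp only [gap, mem_filter] at hy hy'
        omega
      simp [this, NCP.monom]
  · have : ∃ x ∈ L, ∃ y ∉ L, x ≤ y := by
      by_contra! hcon
      exact h fun x y hxy hx => by_contra fun hy => (hcon x hx y hy).not_ge hxy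
    obtain ⟨x, hx, y, hy, hxy⟩ := this
    have hxy : x < y := lt_of_le_of_ne hxy (by rintro rfl; exact hy hx)
    have hpos : 0 < (L.filter fun x => x < y).card := card_pos.2 ⟨x, by simp [hx, hxy]⟩
    have hle : (L.filter fun x => x < y).card ≤ L.card := card_filter_le _ _
    rw [map_list_prod, List.prod_eq_zero, mul_zero]
    simp only [List.map_map, List.mem_map, List.mem_range]
    -- The gap of `y` has positive index because `x ∈ L` lies below `y`; the list enumerates the
    -- gaps of index `i + 1`, hence the shift.
    refine ⟨(L.filter fun x => x < y).card - 1, by omega, ?_⟩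
    have hne : (gap L ((L.filter fun x => x < y).card - 1 + 1)).Nonempty :=
      ⟨y, by simp only [gap, mem_filter, mem_univ, true_and]; exact ⟨hy, by omega⟩⟩
    simp [NCP.monom, hne]

theorem succ_one (α κ : Module.Dual 𝕂 (Hgap 𝕂)) : succ α κ 1 = 0 := by
  have h := coproductSucc_word (𝕂 := 𝕂) []
  simp only [List.map_nil, List.prod_nil, coproductSuccWord] at h
  simp [succ, h]

theorem succ_word {κ : Module.Dual 𝕂 (Hgap 𝕂)} (hκ : IsInfinitesimal κ)
    (α : Module.Dual 𝕂 (Hgap 𝕂)) (P : NCP) (w : List NCP) :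
    succ α κ (gen 𝕂 P * (w.map (gen 𝕂)).prod) =
      ∑ L ∈ tails P.rel, P.monom (fun R => κ (gen 𝕂 R)) Lᶜ *
        α (P.monom (gen 𝕂) L * (w.map (gen 𝕂)).prod) := by
  classical
  have h := coproductSucc_word (𝕂 := 𝕂) (P :: w)
  rw [List.map_cons, List.prod_cons, coproductSuccWord] at h
  simp only [succ, LinearMap.comp_apply, h, sum_mul, map_sum, cutTerm]
  calc _ = ∑ L ∈ P.cuts.filter (fun L => (⟨0, P.deg_pos⟩ : Fin P.deg) ∉ L),
        if IsUpperSet (L : Set (Fin P.deg)) then P.monom (fun R => κ (gen 𝕂 R)) Lᶜ *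
          α (P.monom (gen 𝕂) L * (w.map (gen 𝕂)).prod) else 0 := by
        refine sum_congr rfl fun L hL => ?_
        have hL0 := infinitesimal_gapMonomial hκ P (mem_filter.1 hL).2
        rw [apply_tmul_mul hκ α _ hL0.1, coproduct_counit, hL0.2, ite_mul, zero_mul]
    _ = _ := by
        rw [← sum_filter]
        congr 1
        ext L
        simp only [NCP.cuts, mem_tails, mem_filter, mem_univ, true_and]
        constructor
        · rintro ⟨⟨h1, h2⟩, h3⟩
          exact ⟨h3, (zero_notMem_iff h3 P.deg_pos).1 h2, (isLowerset_iff h3).1 h1⟩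
        · rintro ⟨h3, h2, h1⟩
          exact ⟨⟨(isLowerset_iff h3).2 h1, (zero_notMem_iff h3 P.deg_pos).2 h2⟩, h3⟩

/-! ### The fixpoint equation as a recursion; uniqueness -/

theorem rightFixpoint_iff {κ : Module.Dual 𝕂 (Hgap 𝕂)} (hκ : IsInfinitesimal κ)
    (α : Module.Dual 𝕂 (Hgap 𝕂)) :
    RightFixpoint κ α ↔ α 1 = 1 ∧ ∀ (P : NCP) (w : List NCP),
      α (gen 𝕂 P * (w.map (gen 𝕂)).prod) =
        ∑ L ∈ tails P.rel, P.monom (fun R => κ (gen 𝕂 R)) Lᶜ *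
          α (P.monom (gen 𝕂) L * (w.map (gen 𝕂)).prod) := by
  constructor
  · intro h
    refine ⟨?_, fun P w => ?_⟩
    · rw [h]
      simp [succ_one]
    · rw [← succ_word hκ]
      conv_lhs => rw [h]
      simp
  · rintro ⟨h1, h2⟩
    refine dual_ext_words fun w => ?_
    rcases w with _ | ⟨P, w⟩
    · simp [succ_one, h1]
    · rw [List.map_cons, List.prod_cons, h2, LinearMap.add_apply, succ_word hκ]
      simp

/-- For a character the factor `φ(w)` comes out of the recursion, so single letters suffice. -/
theorem rightFixpoint_algHom_iff {κ : Module.Dual 𝕂 (Hgap 𝕂)} (hκ : IsInfinitesimal κ)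
    (φ : Hgap 𝕂 →ₐ[𝕂] 𝕂) :
    RightFixpoint κ φ.toLinearMap ↔ ∀ P : NCP, φ (gen 𝕂 P) =
        ∑ L ∈ tails P.rel, P.monom (fun R => κ (gen 𝕂 R)) Lᶜ *
          P.monom (fun R => φ (gen 𝕂 R)) L := by
  rw [rightFixpoint_iff hκ]
  simp only [AlgHom.toLinearMap_apply, map_one, true_and, map_mul, map_monom, ← mul_assoc,
    ← sum_mul]
  exact ⟨fun h P => by simpa using h P [], fun h P w => by rw [h]⟩

theorem RightFixpoint.unique {κ : Module.Dual 𝕂 (Hgap 𝕂)} (hκ : IsInfinitesimal κ)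
    {α β : Module.Dual 𝕂 (Hgap 𝕂)} (hα : RightFixpoint κ α) (hβ : RightFixpoint κ β) :
    α = β := by
  rw [rightFixpoint_iff hκ] at hα hβ
  refine dual_ext_words fun w => ?_
  induction hd : (w.map NCP.deg).sum using Nat.strong_induction_on generalizing w with
  | _ d ih =>
    rcases w with _ | ⟨P, w⟩
    · simp [hα.1, hβ.1]
    · rw [List.map_cons, List.prod_cons, hα.2, hβ.2]
      rw [List.map_cons, List.sum_cons] at hd
      refine sum_congr rfl fun L hL => ?_
      congr 1
      have hP := P.deg_pos
      -- If `L` is nonempty the first letter shrinks, as `L` is proper; if `L` is empty the letter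
      -- disappears. Both lower the total degree.
      by_cases hne : L.Nonempty
      · have hlt : L.card < P.deg := by
          simpa using card_lt_univ_of_notMem
            ((zero_notMem_iff (mem_tails.1 hL).1 hP).2 (mem_tails.1 hL).2.1)
        simpa [NCP.monom, hne] using ih ((P.restrict L hne).deg + (w.map NCP.deg).sum)
          (by simp only [NCP.restrict]; omega) (P.restrict L hne :: w) (by simp)
      · simpa [NCP.monom, hne] using ih _ (by omega) w rfl

/-! ### Interval partitions -/

/-- The partition is into intervals. -/
def IsInterval {n : ℕ} (s : Setoid (Fin n)) : Prop :=
  ∀ a c b : Fin n, a ≤ c → c ≤ b → s a b → s a c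

theorem IsInterval.isNoncrossing {n : ℕ} {s : Setoid (Fin n)} (hs : IsInterval s) :
    IsNoncrossing s :=
  fun a c b _ hac hcb _ hab _ => hs a c b hac.le hcb.le hab

instance instFiniteSetoidFin (n : ℕ) : Finite (Setoid (Fin n)) :=
  Finite.of_injective (fun (t : Setoid (Fin n)) (x y : Fin n) => t x y)
    fun _ _ h => Setoid.ext fun x y => iff_of_eq (congrFun (congrFun h x) y)

/-- The interval partitions coarser than or equal to `s`. -/
def intervalCoarsenings {n : ℕ} (s : Setoid (Fin n)) : Finset (Setoid (Fin n)) :=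
  (Set.toFinite {t | s ≤ t ∧ IsInterval t}).toFinset

theorem mem_intervalCoarsenings {n : ℕ} {s t : Setoid (Fin n)} :
    t ∈ intervalCoarsenings s ↔ s ≤ t ∧ IsInterval t := by
  simp [intervalCoarsenings]

/-- The sum over the interval partitions coarser than `s` of the product of the weights of their
blocks. -/
def intervalSum {n : ℕ} (s : Setoid (Fin n)) (w : Finset (Fin n) → 𝕂) : 𝕂 :=
  ∑ t ∈ intervalCoarsenings s, ∏ τ ∈ blocks t, w τ

open scoped Classical in
/-- The complement of the first block. -/
def laterBlocks {n : ℕ} (hn : 0 < n) (t : Setoid (Fin n)) : Finset (Fin n) :=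
  univ.filter fun x => ¬ t ⟨0, hn⟩ x

theorem mem_laterBlocks {n : ℕ} {hn : 0 < n} {t : Setoid (Fin n)} {x : Fin n} :
    x ∈ laterBlocks hn t ↔ ¬ t ⟨0, hn⟩ x := by
  simp [laterBlocks]

theorem laterBlocks_mem_tails {n : ℕ} (hn : 0 < n) {s t : Setoid (Fin n)}
    (ht : t ∈ intervalCoarsenings s) : laterBlocks hn t ∈ tails s := by
  obtain ⟨hst, ht⟩ := mem_intervalCoarsenings.1 ht
  refine mem_tails.2 ⟨fun x y hxy hx => ?_, fun h => ?_, fun x y hxy hy => ?_⟩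
  · rw [mem_coe, mem_laterBlocks] at hx ⊢
    exact fun hy => hx (ht _ x y (Nat.zero_le _) hxy hy)
  · have h0 : (⟨0, hn⟩ : Fin n) ∈ laterBlocks hn t := h ▸ mem_univ _
    exact mem_laterBlocks.1 h0 (t.refl _)
  · rw [mem_laterBlocks] at hy ⊢
    exact fun hx => hy (t.trans hx (hst hxy))

/-- The partition whose blocks are the complement of `L` and the blocks of the partition `r`
of `L`. -/
def addFirstBlock {n : ℕ} (L : Finset (Fin n)) (r : Setoid (Fin L.card)) : Setoid (Fin n) where
  r x y := (x ∉ L ∧ y ∉ L) ∨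
    ∃ a b, L.orderEmbOfFin rfl a = x ∧ L.orderEmbOfFin rfl b = y ∧ r a b
  iseqv := by
    refine ⟨fun x => ?_, ?_, ?_⟩
    · by_cases hx : x ∈ L
      · rw [← mem_coe, ← L.range_orderEmbOfFin rfl] at hx
        obtain ⟨a, rfl⟩ := hx
        exact Or.inr ⟨a, a, rfl, rfl, r.refl a⟩
      · exact Or.inl ⟨hx, hx⟩
    · rintro x y (h | ⟨a, b, rfl, rfl, h⟩)
      · exact Or.inl h.symm
      · exact Or.inr ⟨b, a, rfl, rfl, r.symm h⟩
    · rintro x y z (h | ⟨a, b, rfl, rfl, h⟩) (h' | ⟨c, d, hc, rfl, h'⟩)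
      · exact Or.inl ⟨h.1, h'.2⟩
      · exact absurd (hc ▸ L.orderEmbOfFin_mem rfl c) h.2
      · exact absurd (L.orderEmbOfFin_mem rfl b) h'.1
      · obtain rfl := (L.orderEmbOfFin rfl).injective hc
        exact Or.inr ⟨a, d, rfl, rfl, r.trans h h'⟩

theorem addFirstBlock_apply {n : ℕ} {L : Finset (Fin n)} {r : Setoid (Fin L.card)} {x y : Fin n} :
    addFirstBlock L r x y ↔ (x ∉ L ∧ y ∉ L) ∨
      ∃ a b, L.orderEmbOfFin rfl a = x ∧ L.orderEmbOfFin rfl b = y ∧ r a b :=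
  Iff.rfl

theorem exists_orderEmbOfFin {n : ℕ} {L : Finset (Fin n)} {x : Fin n} (hx : x ∈ L) :
    ∃ a, L.orderEmbOfFin rfl a = x := by
  rwa [← mem_coe, ← L.range_orderEmbOfFin rfl] at hx

theorem comap_addFirstBlock {n : ℕ} (L : Finset (Fin n)) (r : Setoid (Fin L.card)) :
    Setoid.comap (L.orderEmbOfFin rfl) (addFirstBlock L r) = r := by
  refine Setoid.ext fun a b => ?_
  rw [Setoid.comap_rel, addFirstBlock_apply]
  constructor
  · rintro (h | ⟨c, d, hc, hd, h⟩)
    · exact absurd (L.orderEmbOfFin_mem rfl a) h.1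
    · rwa [← (L.orderEmbOfFin rfl).injective hc, ← (L.orderEmbOfFin rfl).injective hd]
  · exact fun h => Or.inr ⟨a, b, rfl, rfl, h⟩

theorem laterBlocks_rel {n : ℕ} {hn : 0 < n} {t : Setoid (Fin n)} {x y : Fin n}
    (hx : x ∈ laterBlocks hn t) (h : t x y) : y ∈ laterBlocks hn t := by
  rw [mem_laterBlocks] at hx ⊢
  exact fun hy => hx (t.trans hy (t.symm h))

theorem addFirstBlock_comap {n : ℕ} (hn : 0 < n) (t : Setoid (Fin n)) :
    addFirstBlock (laterBlocks hn t)
      (Setoid.comap ((laterBlocks hn t).orderEmbOfFin rfl) t) = t := by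
  refine Setoid.ext fun x y => ?_
  rw [addFirstBlock_apply]
  constructor
  · rintro (⟨hx, hy⟩ | ⟨a, b, rfl, rfl, h⟩)
    · rw [mem_laterBlocks, not_not] at hx hy
      exact t.trans (t.symm hx) hy
    · exact h
  · intro h
    by_cases hx : x ∈ laterBlocks hn t
    · obtain ⟨a, rfl⟩ := exists_orderEmbOfFin hx
      obtain ⟨b, rfl⟩ := exists_orderEmbOfFin (laterBlocks_rel hx h)
      exact Or.inr ⟨a, b, rfl, rfl, h⟩
    · exact Or.inl ⟨hx, fun hy => hx (laterBlocks_rel hy (t.symm h))⟩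

theorem addFirstBlock_mem {n : ℕ} (hn : 0 < n) {s : Setoid (Fin n)} {L : Finset (Fin n)}
    (hL : L ∈ tails s) {r : Setoid (Fin L.card)}
    (hr : r ∈ intervalCoarsenings (Setoid.comap (L.orderEmbOfFin rfl) s)) :
    addFirstBlock L r ∈ intervalCoarsenings s ∧ laterBlocks hn (addFirstBlock L r) = L := by
  obtain ⟨hsr, hr⟩ := mem_intervalCoarsenings.1 hr
  obtain ⟨hup, hne, hs⟩ := mem_tails.1 hL
  have h0 := (zero_notMem_iff hup hn).2 hne
  refine ⟨mem_intervalCoarsenings.2 ⟨fun x y hxy => ?_, ?_⟩, ?_⟩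
  · by_cases hx : x ∈ L
    · obtain ⟨a, rfl⟩ := exists_orderEmbOfFin hx
      obtain ⟨b, rfl⟩ := exists_orderEmbOfFin (hs _ _ (s.symm hxy) hx)
      exact Or.inr ⟨a, b, rfl, rfl, hsr hxy⟩
    · exact Or.inl ⟨hx, fun hy => hx (hs _ _ hxy hy)⟩
  · rintro x z y hxz hzy (⟨hx, hy⟩ | ⟨a, b, rfl, rfl, h⟩)
    · exact Or.inl ⟨hx, fun hz => hy (hup hzy hz)⟩
    · obtain ⟨c, rfl⟩ := exists_orderEmbOfFin (hup hxz (L.orderEmbOfFin_mem rfl a))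
      rw [OrderEmbedding.le_iff_le] at hxz hzy
      exact Or.inr ⟨a, c, rfl, rfl, hr a c b hxz hzy h⟩
  · ext x
    rw [mem_laterBlocks, addFirstBlock_apply]
    constructor
    · exact fun h => by_contra fun hx => h (Or.inl ⟨h0, hx⟩)
    · rintro hx (⟨-, h⟩ | ⟨a, -, ha, -⟩)
      · exact h hx
      · exact h0 (ha ▸ L.orderEmbOfFin_mem rfl a)

theorem mem_blocks {n : ℕ} {s : Setoid (Fin n)} {τ : Finset (Fin n)} :
    τ ∈ blocks s ↔ ∃ x, ∀ y, y ∈ τ ↔ s x y := by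
  classical
  simp only [blocks, mem_image, mem_univ, true_and]
  refine exists_congr fun x => ?_
  rw [eq_comm, Finset.ext_iff]
  simp

/-- Separates the block of the least element from the others, which are the blocks of the
restriction to `laterBlocks`. -/
theorem blocks_eq {n : ℕ} (hn : 0 < n) (t : Setoid (Fin n)) :
    blocks t = insert (laterBlocks hn t)ᶜ
      ((blocks (Setoid.comap ((laterBlocks hn t).orderEmbOfFin rfl) t)).map
        (mapEmbedding ((laterBlocks hn t).orderEmbOfFin rfl).toEmbedding).toEmbedding) := by
  ext τ
  simp only [mem_insert, mem_map, mem_blocks, RelEmbedding.coe_toEmbedding, mapEmbedding_apply]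
  constructor
  · rintro ⟨x, hx⟩
    by_cases hL : x ∈ laterBlocks hn t
    · right
      classical
      obtain ⟨a, rfl⟩ := exists_orderEmbOfFin hL
      refine ⟨univ.filter fun b => t ((laterBlocks hn t).orderEmbOfFin rfl a)
        ((laterBlocks hn t).orderEmbOfFin rfl b), ⟨a, fun b => by simp [Setoid.comap_rel]⟩, ?_⟩
      ext y
      simp only [mem_map, mem_filter, mem_univ, true_and, hx, RelEmbedding.coe_toEmbedding]
      constructor
      · rintro ⟨b, hb, rfl⟩
        exact hb
      · intro hy
        obtain ⟨b, rfl⟩ := exists_orderEmbOfFin (laterBlocks_rel hL hy)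
        exact ⟨b, hy, rfl⟩
    · left
      ext y
      rw [mem_laterBlocks, not_not] at hL
      rw [hx, mem_compl, mem_laterBlocks, not_not]
      exact ⟨fun h => t.trans hL h, fun h => t.trans (t.symm hL) h⟩
  · rintro (rfl | ⟨σ, ⟨a, ha⟩, rfl⟩)
    · exact ⟨⟨0, hn⟩, fun y => by rw [mem_compl, mem_laterBlocks, not_not]⟩
    · refine ⟨(laterBlocks hn t).orderEmbOfFin rfl a, fun y => ?_⟩
      simp only [mem_map, ha, RelEmbedding.coe_toEmbedding]
      constructor
      · rintro ⟨b, hb, rfl⟩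
        exact hb
      · intro hy
        obtain ⟨b, rfl⟩ := exists_orderEmbOfFin
          (laterBlocks_rel ((laterBlocks hn t).orderEmbOfFin_mem rfl a) hy)
        exact ⟨b, hy, rfl⟩

theorem prod_blocks {n : ℕ} (hn : 0 < n) (t : Setoid (Fin n)) (w : Finset (Fin n) → 𝕂) :
    ∏ τ ∈ blocks t, w τ = w (laterBlocks hn t)ᶜ *
      ∏ τ ∈ blocks (Setoid.comap ((laterBlocks hn t).orderEmbOfFin rfl) t),
        w (τ.map ((laterBlocks hn t).orderEmbOfFin rfl).toEmbedding) := by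
  rw [blocks_eq hn t, prod_insert, prod_map]
  · rfl
  · simp only [mem_map, RelEmbedding.coe_toEmbedding, mapEmbedding_apply, not_exists, not_and]
    rintro σ - h
    have h0 : (⟨0, hn⟩ : Fin n) ∈ (laterBlocks hn t)ᶜ := by
      rw [mem_compl, mem_laterBlocks, not_not]
    obtain ⟨a, -, ha⟩ := mem_map.1 (h ▸ h0)
    exact mem_compl.1 h0 (ha ▸ (laterBlocks hn t).orderEmbOfFin_mem rfl a)

/-- The interval coarsenings are sorted by the complement `L` of their first block, which ranges
over `tails s`. For fixed `L`, restriction to `L` and `addFirstBlock` are inverse bijections onto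
the interval coarsenings of the restriction of `s`. -/
theorem intervalSum_rec {n : ℕ} (hn : 0 < n) (s : Setoid (Fin n)) (w : Finset (Fin n) → 𝕂) :
    intervalSum s w = ∑ L ∈ tails s, w Lᶜ *
      intervalSum (Setoid.comap (L.orderEmbOfFin rfl) s)
        fun τ => w (τ.map (L.orderEmbOfFin rfl).toEmbedding) := by
  unfold intervalSum
  rw [← sum_fiberwise_of_maps_to fun t ht => laterBlocks_mem_tails hn ht]
  refine sum_congr rfl fun L hL => ?_
  rw [mul_sum]
  refine sum_bij' (fun t _ => Setoid.comap (L.orderEmbOfFin rfl) t)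
    (fun r _ => addFirstBlock L r) ?_ ?_ ?_ ?_ ?_
  · intro t ht
    obtain ⟨hst, ht⟩ := mem_intervalCoarsenings.1 (mem_filter.1 ht).1
    exact mem_intervalCoarsenings.2 ⟨fun a b h => hst h, fun a c b hac hcb hab =>
      ht _ _ _ ((L.orderEmbOfFin rfl).monotone hac) ((L.orderEmbOfFin rfl).monotone hcb) hab⟩
  · exact fun r hr => mem_filter.2 (addFirstBlock_mem hn hL hr)
  · intro t ht
    obtain rfl := (mem_filter.1 ht).2
    exact addFirstBlock_comap hn t
  · exact fun r _ => comap_addFirstBlock L r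
  · intro t ht
    obtain rfl := (mem_filter.1 ht).2
    exact prod_blocks hn t w

/-- The end of the recursion: the empty partition has one coarsening and an empty product, matching
the value `1` of `NCP.monom` on `∅`. -/
theorem intervalSum_zero (s : Setoid (Fin 0)) (w : Finset (Fin 0) → 𝕂) : intervalSum s w = 1 := by
  have h : intervalCoarsenings s = {s} := by
    ext t
    rw [mem_intervalCoarsenings, mem_singleton]
    exact ⟨fun _ => Setoid.ext fun x => x.elim0, fun h => h ▸ ⟨le_rfl, fun x => x.elim0⟩⟩
  have h' : blocks s = ∅ := by simp [blocks]
  rw [intervalSum, h, sum_singleton, h', prod_empty]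

/-! ### The explicit solution of the fixpoint equation -/

/-- The character whose value at `P` is the sum over the interval partitions `Q ≥ P` of the
products of the `κ(P_{|τ})` over the blocks `τ` of `Q`. -/
def intervalCharacter (κ : Module.Dual 𝕂 (Hgap 𝕂)) : Hgap 𝕂 →ₐ[𝕂] 𝕂 :=
  FreeAlgebra.lift 𝕂 fun P => intervalSum P.rel (P.monom fun R => κ (gen 𝕂 R))

theorem intervalCharacter_gen (κ : Module.Dual 𝕂 (Hgap 𝕂)) (P : NCP) :
    intervalCharacter κ (gen 𝕂 P) = intervalSum P.rel (P.monom fun R => κ (gen 𝕂 R)) := by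
  simp [intervalCharacter, gen]

theorem rightFixpoint_intervalCharacter {κ : Module.Dual 𝕂 (Hgap 𝕂)} (hκ : IsInfinitesimal κ) :
    RightFixpoint κ (intervalCharacter κ).toLinearMap := by
  refine (rightFixpoint_algHom_iff hκ _).2 fun P => ?_
  rw [intervalCharacter_gen, intervalSum_rec P.deg_pos]
  refine sum_congr rfl fun L _ => ?_
  congr 1
  by_cases hL : L.Nonempty
  · have h : P.monom (fun R => intervalCharacter κ (gen 𝕂 R)) L =
        intervalCharacter κ (gen 𝕂 (P.restrict L hL)) := dif_pos hL
    rw [h, intervalCharacter_gen]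
    exact congrArg (intervalSum _) (funext fun τ => (P.monom_restrict _ L hL τ).symm)
  · obtain rfl := not_nonempty_iff_eq_empty.1 hL
    rw [NCP.monom, dif_neg hL]
    exact intervalSum_zero _ _

/-! ### The universal character and the block-substitution action -/

theorem card_blocks_eq_one_iff {n : ℕ} (hn : 0 < n) (s : Setoid (Fin n)) :
    (blocks s).card = 1 ↔ ∀ x y, s x y := by
  classical
  rw [card_eq_one]
  constructor
  · rintro ⟨τ, hτ⟩ x y
    have h : ∀ z, univ.filter (fun y => s z y) = τ := fun z => by
      rw [← mem_singleton, ← hτ, mem_blocks]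
      exact ⟨z, by simp⟩
    have hy : y ∈ univ.filter (fun z => s x z) := by
      rw [h x, ← h y]
      simp
    simpa using hy
  · intro h
    refine ⟨univ, ?_⟩
    ext τ
    rw [mem_blocks, mem_singleton, Finset.eq_univ_iff_forall]
    exact ⟨fun ⟨x, hx⟩ y => (hx y).2 (h x y), fun hτ => ⟨⟨0, hn⟩, fun y => by simp [hτ, h]⟩⟩

open scoped Classical in
theorem monom_eForm (P : NCP) (X : Finset (Fin P.deg)) :
    P.monom (fun R => eForm 𝕂 (gen 𝕂 R)) X =
      if ∀ x ∈ X, ∀ y ∈ X, P.rel x y then 1 else 0 := by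
  by_cases hX : X.Nonempty
  · rw [NCP.monom, dif_pos hX, eForm_gen]
    refine if_congr ?_ rfl rfl
    rw [card_blocks_eq_one_iff (P.restrict X hX).deg_pos]
    constructor
    · intro h x hx y hy
      obtain ⟨a, rfl⟩ := exists_orderEmbOfFin hx
      obtain ⟨b, rfl⟩ := exists_orderEmbOfFin hy
      exact h a b
    · exact fun h a b => h _ (X.orderEmbOfFin_mem rfl a) _ (X.orderEmbOfFin_mem rfl b)
  · rw [NCP.monom, dif_neg hX, if_pos]
    exact fun x hx => absurd ⟨x, hx⟩ hX

-- The product for a coarsening `t` is nonzero only if every block of `t` lies in a block of `P`,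
-- which forces `t = P`; this term occurs precisely when `P` is an interval partition.
open scoped Classical in
theorem intervalCharacter_eForm_gen (P : NCP) :
    intervalCharacter (eForm 𝕂) (gen 𝕂 P) = if IsInterval P.rel then 1 else 0 := by
  have key : ∀ t ∈ intervalCoarsenings P.rel,
      ∏ τ ∈ blocks t, P.monom (fun R => eForm 𝕂 (gen 𝕂 R)) τ = if t = P.rel then 1 else 0 := by
    intro t ht
    split_ifs with h
    · subst h
      refine prod_eq_one fun τ hτ => ?_
      obtain ⟨x, hx⟩ := mem_blocks.1 hτ
      rw [monom_eForm, if_pos]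
      exact fun a ha b hb => P.rel.trans (P.rel.symm ((hx a).1 ha)) ((hx b).1 hb)
    · have : ¬ t ≤ P.rel := fun h' => h (le_antisymm h' (mem_intervalCoarsenings.1 ht).1)
      obtain ⟨x, y, hxy, hn⟩ : ∃ x y, t x y ∧ ¬ P.rel x y := by
        by_contra! hcon
        exact this fun {x y} => hcon x y
      refine prod_eq_zero (i := univ.filter fun y => t x y)
        (mem_blocks.2 ⟨x, by simp⟩) ?_
      rw [monom_eForm, if_neg]
      exact fun h => hn (h x (by simp) y (by simpa using hxy))
  rw [intervalCharacter_gen, intervalSum, sum_congr rfl key, sum_ite_eq']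
  exact if_congr (mem_intervalCoarsenings.trans (and_iff_right le_rfl)) rfl rfl

/-- The choice in `rightExp` is meaningful because `intervalCharacter` provides a character solving
the equation. -/
theorem rightFixpoint_psiSucc : RightFixpoint (eForm 𝕂) (psiSucc 𝕂).toLinearMap :=
  Classical.epsilon_spec (p := fun φ : Hgap 𝕂 →ₐ[𝕂] 𝕂 => RightFixpoint (eForm 𝕂) φ.toLinearMap)
    ⟨_, rightFixpoint_intervalCharacter isInfinitesimal_eForm⟩

theorem psiSucc_eq : psiSucc 𝕂 = intervalCharacter (eForm 𝕂) :=
  AlgHom.toLinearMap_injective (rightFixpoint_psiSucc.unique isInfinitesimal_eForm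
    (rightFixpoint_intervalCharacter isInfinitesimal_eForm))

theorem act_algHom (φ : Hgap 𝕂 →ₐ[𝕂] 𝕂) (χ : Bbl 𝕂 →ₐ[𝕂] 𝕂) :
    act φ.toLinearMap χ = ((Algebra.TensorProduct.lmul' 𝕂).comp
      ((Algebra.TensorProduct.map φ χ).comp (coaction 𝕂))).toLinearMap :=
  rfl

theorem act_psiSucc (κ : Module.Dual 𝕂 (Hgap 𝕂)) :
    act (psiSucc 𝕂).toLinearMap (bar (theta κ)) = (intervalCharacter κ).toLinearMap := by
  classical
  rw [act_algHom]
  congr 1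
  refine FreeAlgebra.hom_ext (funext fun P => ?_)
  change _ = intervalCharacter κ (gen 𝕂 P)
  have hmon : ∀ τ, bar (theta κ) (P.monom MvPolynomial.X τ) =
      P.monom (fun R => κ (gen 𝕂 R)) τ := fun τ => by
    simp [map_monom, bar, theta, gen]
  rw [intervalCharacter_gen]
  simp only [coaction, Function.comp_apply, AlgHom.comp_apply, FreeAlgebra.lift_ι_apply, map_sum,
    Algebra.TensorProduct.map_tmul, Algebra.TensorProduct.lmul'_apply_tmul, psiSucc_eq,
    intervalCharacter_eForm_gen, fibre, map_prod, hmon, ite_mul, one_mul, zero_mul]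
  rw [← sum_filter, intervalSum]
  -- Interval partitions are noncrossing, so the noncrossing coarsenings selected by `ψ_≻` are all
  -- the interval coarsenings.
  refine sum_bij (fun Q _ => Q.1) ?_ (fun _ _ _ _ h => Subtype.ext h) ?_ fun _ _ => rfl
  · exact fun Q hQ => mem_intervalCoarsenings.2 ⟨Q.2.1, (mem_filter.1 hQ).2⟩
  · intro t ht
    obtain ⟨h1, h2⟩ := mem_intervalCoarsenings.1 ht
    exact ⟨⟨t, h1, h2.isNoncrossing⟩, mem_filter.2 ⟨mem_univ _, h2⟩, rfl⟩

end GapInsertion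
end

/-- The character `ψ_≻ = E_≻(e)` is well defined, being the only linear form `ψ` with
`ψ = ε + ψ ≻ e`; and a character `φ` satisfies `φ = ε + φ ≻ κ` if and only if `φ = ψ_≻ ↶ K`. -/
theorem mainTheorem10 (𝕂 : Type*) [Field 𝕂] [CharZero 𝕂] :
    (GapInsertion.IsInfinitesimal (GapInsertion.eForm 𝕂) ∧
      GapInsertion.RightFixpoint (GapInsertion.eForm 𝕂) (GapInsertion.psiSucc 𝕂).toLinearMap ∧
      ∀ ψ : Module.Dual 𝕂 (GapInsertion.Hgap 𝕂),
        GapInsertion.RightFixpoint (GapInsertion.eForm 𝕂) ψ →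
          ψ = (GapInsertion.psiSucc 𝕂).toLinearMap) ∧
    ∀ κ : Module.Dual 𝕂 (GapInsertion.Hgap 𝕂), GapInsertion.IsInfinitesimal κ →
      ∀ φ : GapInsertion.Hgap 𝕂 →ₐ[𝕂] 𝕂,
        φ.toLinearMap = (GapInsertion.counit 𝕂).toLinearMap +
            GapInsertion.succ φ.toLinearMap κ ↔
          φ.toLinearMap =
            GapInsertion.act (GapInsertion.psiSucc 𝕂).toLinearMap
              (GapInsertion.bar (GapInsertion.theta κ)) := by
  exact ⟨⟨GapInsertion.isInfinitesimal_eForm, GapInsertion.rightFixpoint_psiSucc, fun ψ hψ =>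
      hψ.unique GapInsertion.isInfinitesimal_eForm GapInsertion.rightFixpoint_psiSucc⟩,
    fun κ hκ φ => by
      rw [GapInsertion.act_psiSucc]
      have hκφ := GapInsertion.rightFixpoint_intervalCharacter hκ
      exact ⟨fun h => GapInsertion.RightFixpoint.unique hκ h hκφ, fun h => h ▸ hκφ⟩⟩
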